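/- A multi-weighted game graph $\langle V,E,d\rangle$ of dimension $d\in\mathbb N$ consists of a finite set of vertices $V=V_1\uplus V_2$, partitioned into Player 1 vertices $V_1$ and Player 2 vertices $V_2$, and a finite set of edges $E\subseteq V\times\mathbb Z^d\times V$ such that every vertex has at least one outgoing edge. A configuration is a pair $(v,\mathbf a)\in V\times\mathbb Z^d$. A path is a finite sequence of configurations $(v_0,\mathbf a_0)\cdots(v_n,\mathbf a_n)$ with $(v_j,\mathbf a_{j+1}-\mathbf a_j,v_{j+1})\in E$ for all $0\le j<n$; it is a cycle if $n\ge 1$ and $v_0=v_n$. A play from $v_0$ is an infinite sequence of configurations $\rho=(v_0,\mathbf a_0)(v_1,\mathbf a_1)\cdots$ with $\mathbf a_0=\mathbf 0$ all of whose finite prefixes are paths; the weight of its prefix of length $n$ is $w(\rho|_n)=\mathbf a_n-\mathbf a_0=\mathbf a_n$. A strategy for Player $p\in\{1,2\}$ maps every non-empty path ending in a vertex $v\in V_p$ to an edge of $E$ with source $v$. Two strategies, one for each player, determine a unique play from $v_0$ consistent with both. Player $p$ wins a game from $v_0$ if Player $p$ has a strategy such that, against every strategy of the other player, the resulting play from $v_0$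 is won by Player $p$. In the energy game $\Delta_{\mathbf b}\langle V,E,d\rangle$ with initial credit $\mathbf b\in\mathbb N^d$, Player 1 wins a play $\rho$ if $\mathbf b+w(\rho|_n)\ge\mathbf 0$ componentwise for all $n$, and Player 2 wins it otherwise. In the bounding game $\Gamma\langle V,E,d\rangle$, Player 1 wins a play $\rho$ if the set $\{\|w(\rho|_n)\| : n\in\mathbb N\}$ is bounded, where $\|\mathbf a\|=\max_i|\mathbf a(i)|$, and Player 2 wins it otherwise. The lossy game graph $\mathrm{lossy}\langle V,E,d\rangle$ is obtained from $\langle V,E,d\rangle$ by adding, at each Player 1 vertex and for each $1\le i\le d$, a self-loop with weight $-\mathbf e_i$, the negative $i$-th unit vector. **Proposition.** Let $\langle V,E,d\rangle$ be a multi-weighted game graph in which every cycle contains at least one Player 1 vertex. Then from any vertex $v_0\in V$: 1. Player 1 wins the energy game $\Delta_{\mathbf b}\langle V,E,d\rangle$ for some $\mathbf b\in\mathbb N^d$ if and only if Player 1 wins the bounding game $\Gamma(\mathrm{lossy}\langle V,E,d\rangle)$. 2. Player 2 wins the energy game $\Delta_{\mathbf b}\langle V,E,d\rangle$ for all $\mathbf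 b\in\mathbb N^d$ if and only if Player 2 wins the bounding game $\Gamma(\mathrm{lossy}\langle V,E,d\rangle)$. -/

import Mathlib

/-- The two players. -/
inductive Player : Type
  | one
  | two

/-- The other player. -/
def Player.opponent : Player → Player
  | .one => .two
  | .two => .one

/-- A multi-weighted game graph of dimension `d` on the vertex set `V`. The map `owner` is the
partition of `V` into Player 1 vertices and Player 2 vertices; the edges form a finite set of
triples `(v, u, v')`, with source `v`, weight `u` in `ℤ^d` and target `v'`; every vertex has an
outgoing edge. -/
structure GameGraph (V : Type*) (d : ℕ) where
  owner : V → Player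
  edges : Set (V × (Fin d → ℤ) × V)
  finite_edges : edges.Finite
  exists_edge : ∀ v, ∃ u v', (v, u, v') ∈ edges

/-- Configurations `(v, a)`: a vertex and a vector of integers. -/
abbrev Config (V : Type*) (d : ℕ) := V × (Fin d → ℤ)

/-- The weight `a_n - a_0` of the prefix of length `n` of a sequence of configurations. -/
def prefixWeight {V : Type*} {d : ℕ} (ρ : ℕ → Config V d) (n : ℕ) : Fin d → ℤ :=
  (ρ n).2 - (ρ 0).2

/-- Player 1's winning condition in the energy game with initial credit `b`. -/
def EnergyCond {V : Type*} {d : ℕ} (b : Fin d → ℕ) (ρ : ℕ → Config V d) : Prop :=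
  ∀ n, 0 ≤ (fun i => (b i : ℤ)) + prefixWeight ρ n

/-- Player 1's winning condition in the bounding game; `‖·‖` is the maximum norm on `ℤ^d`. -/
def BoundingCond {V : Type*} {d : ℕ} (ρ : ℕ → Config V d) : Prop :=
  BddAbove (Set.range fun n => ‖prefixWeight ρ n‖)

/-- Who wins a play, if `W` is the winning condition of Player 1: Player 2 wins exactly the plays
that Player 1 does not win. -/
def WinsPlay {V : Type*} {d : ℕ} (W : (ℕ → Config V d) → Prop) : Player → (ℕ → Config V d) → Prop
  | .one, ρ => W ρ
  | .two, ρ => ¬ W ρ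

namespace GameGraph

/-- One move between configurations along an edge. -/
def Step {V : Type*} {d : ℕ} (G : GameGraph V d) (c c' : Config V d) : Prop :=
  (c.1, c'.2 - c.2, c'.1) ∈ G.edges

/-- Paths: finite sequences of configurations in which consecutive ones are linked by an edge. -/
def IsPath {V : Type*} {d : ℕ} (G : GameGraph V d) (π : List (Config V d)) : Prop :=
  π.IsChain G.Step

/-- Every cycle (a path with at least one edge whose first and last vertices agree) contains a
Player 1 vertex. -/
def EveryCycleMeetsPlayerOne {V : Type*} {d : ℕ} (G : GameGraph V d) : Prop :=
  ∀ (c : Config V d) (π : List (Config V d)) (c' : Config V d),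
    G.IsPath (c :: (π ++ [c'])) → c.1 = c'.1 →
      ∃ x ∈ c :: (π ++ [c']), G.owner x.1 = Player.one

/-- Strategies of Player `p`: to every path `π · c` ending in a vertex of Player `p` they assign
an edge out of that vertex. Values of `next` on other arguments are irrelevant. -/
structure Strategy {V : Type*} {d : ℕ} (G : GameGraph V d) (p : Player) where
  next : List (Config V d) → Config V d → V × (Fin d → ℤ) × V
  next_mem : ∀ π c, G.IsPath (π ++ [c]) → G.owner c.1 = p → next π c ∈ G.edges
  next_source : ∀ π c, G.IsPath (π ++ [c]) → G.owner c.1 = p → (next π c).1 = c.1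

/-- `ρ` is a play from `v₀`. -/
def IsPlayFrom {V : Type*} {d : ℕ} (G : GameGraph V d) (v₀ : V) (ρ : ℕ → Config V d) : Prop :=
  ρ 0 = (v₀, 0) ∧ ∀ n, G.Step (ρ n) (ρ (n + 1))

/-- The play `ρ` is consistent with the strategy `σ` of Player `p`; the list
`(List.range n).map ρ` is `ρ 0, …, ρ (n - 1)`. -/
def Strategy.Consistent {V : Type*} {d : ℕ} {G : GameGraph V d} {p : Player} (σ : G.Strategy p)
    (ρ : ℕ → Config V d) : Prop :=
  ∀ n, G.owner (ρ n).1 = p →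
    σ.next ((List.range n).map ρ) (ρ n) = ((ρ n).1, (ρ (n + 1)).2 - (ρ n).2, (ρ (n + 1)).1)

/-- Player `p` wins from `v₀` the game on `G` in which `W` is Player 1's winning condition: some
strategy of Player `p` wins, against every strategy of the opponent, the play from `v₀` that is
consistent with both (which exists and is unique, see `existsUnique_play`). -/
def Wins {V : Type*} {d : ℕ} (G : GameGraph V d) (W : (ℕ → Config V d) → Prop) (p : Player)
    (v₀ : V) : Prop :=
  ∃ σ : G.Strategy p, ∀ τ : G.Strategy p.opponent, ∀ ρ : ℕ → Config V d,
    G.IsPlayFrom v₀ ρ → σ.Consistent ρ → τ.Consistent ρ → WinsPlay W p ρ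

/-- Player `p` wins the energy game with initial credit `b` from `v₀`. -/
def WinsEnergy {V : Type*} {d : ℕ} (G : GameGraph V d) (b : Fin d → ℕ) (p : Player) (v₀ : V) :
    Prop :=
  G.Wins (EnergyCond b) p v₀

/-- Player `p` wins the bounding game from `v₀`. -/
def WinsBounding {V : Type*} {d : ℕ} (G : GameGraph V d) (p : Player) (v₀ : V) : Prop :=
  G.Wins BoundingCond p v₀

/-- The lossy game graph: at each Player 1 vertex and for each coordinate `i`, a self-loop with
weight `-e_i` is added. -/
def lossy {V : Type*} [Finite V] {d : ℕ} (G : GameGraph V d) : GameGraph V d where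
  owner := G.owner
  edges := G.edges ∪ {e | ∃ v i, G.owner v = Player.one ∧ e = (v, -Pi.single i 1, v)}
  finite_edges := by
    refine G.finite_edges.union
      ((Set.finite_range fun x : V × Fin d => (x.1, -Pi.single x.2 1, x.1)).subset ?_)
    rintro e ⟨v, i, -, rfl⟩
    exact ⟨(v, i), rfl⟩
  exists_edge := fun v => by
    obtain ⟨u, v', h⟩ := G.exists_edge v
    exact ⟨u, v', Or.inl h⟩

/-- For two given strategies, exactly one play from `v₀` is consistent with both. -/
theorem existsUnique_play {V : Type*} {d : ℕ} (G : GameGraph V d) (σ : G.Strategy Player.one)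
    (τ : G.Strategy Player.two) (v₀ : V) :
    ∃! ρ : ℕ → Config V d, G.IsPlayFrom v₀ ρ ∧ σ.Consistent ρ ∧ τ.Consistent ρ := by
  let choice : List (Config V d) → Config V d → V × (Fin d → ℤ) × V := fun l c =>
    match G.owner c.1 with
    | .one => σ.next l c
    | .two => τ.next l c
  have ch1 : ∀ l c, G.owner c.1 = .one → choice l c = σ.next l c := by
    intro l c h; simp only [choice, h]
  have ch2 : ∀ l c, G.owner c.1 = .two → choice l c = τ.next l c := by
    intro l c h; simp only [choice, h]
  have hch : ∀ l c, G.IsPath (l ++ [c]) → choice l c ∈ G.edges ∧ (choice l c).1 = c.1 := by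
    intro l c h
    rcases ho : G.owner c.1 with _ | _
    · rw [ch1 l c ho]; exact ⟨σ.next_mem l c h ho, σ.next_source l c h ho⟩
    · rw [ch2 l c ho]; exact ⟨τ.next_mem l c h ho, τ.next_source l c h ho⟩
  let nxt : List (Config V d) → Config V d → Config V d := fun l c =>
    ((choice l c).2.2, c.2 + (choice l c).2.1)
  let run : ℕ → List (Config V d) × Config V d := fun n =>
    Nat.rec ([], (v₀, 0)) (fun _ s => (s.1 ++ [s.2], nxt s.1 s.2)) n
  have run_succ : ∀ n, run (n + 1) = ((run n).1 ++ [(run n).2], nxt (run n).1 (run n).2) :=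
    fun n => rfl
  have hist : ∀ n, (run n).1 = (List.range n).map fun k => (run k).2 := by
    intro n
    induction n with
    | zero => rfl
    | succ k ih => rw [run_succ, List.range_succ, List.map_append, ← ih]; rfl
  have hedge : ∀ l c, G.IsPath (l ++ [c]) →
      choice l c = (c.1, (nxt l c).2 - c.2, (nxt l c).1) := by
    intro l c h
    have h2 := (hch l c h).2
    simp only [nxt, add_sub_cancel_left, ← h2]
  have hstep : ∀ l c, G.IsPath (l ++ [c]) → G.Step c (nxt l c) := by
    intro l c h
    have h1 := (hch l c h).1
    rw [hedge l c h] at h1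
    exact h1
  have hpath : ∀ n, G.IsPath ((run n).1 ++ [(run n).2]) := by
    intro n
    induction n with
    | zero => exact List.isChain_singleton _
    | succ k ih =>
      have hs := hstep _ _ ih
      rw [run_succ]
      refine List.IsChain.append ih (List.isChain_singleton _) ?_
      intro x hx y hy
      simp only [List.getLast?_append, List.getLast?_singleton, Option.some_or,
        Option.mem_def, Option.some.injEq, List.head?_cons] at hx hy
      subst hx hy
      exact hs
  refine ⟨fun n => (run n).2, ⟨⟨rfl, fun n => hstep _ _ (hpath n)⟩, ?_, ?_⟩, ?_⟩
  · intro n ho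
    rw [← hist n, ← ch1 _ _ ho]
    exact hedge _ _ (hpath n)
  · intro n ho
    rw [← hist n, ← ch2 _ _ ho]
    exact hedge _ _ (hpath n)
  · rintro ρ ⟨⟨h0, -⟩, h1, h2⟩
    have key : ∀ n, (List.range n).map ρ = (run n).1 ∧ ρ n = (run n).2 := by
      intro n
      induction n with
      | zero => exact ⟨rfl, h0⟩
      | succ k ih =>
        obtain ⟨ih1, ih2⟩ := ih
        have hc : choice (run k).1 (run k).2
            = ((ρ k).1, (ρ (k + 1)).2 - (ρ k).2, (ρ (k + 1)).1) := by
          rcases ho : G.owner (ρ k).1 with _ | _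
          · rw [← h1 k ho, ih1, ih2]; exact ch1 _ _ (ih2 ▸ ho)
          · rw [← h2 k ho, ih1, ih2]; exact ch2 _ _ (ih2 ▸ ho)
        refine ⟨?_, ?_⟩
        · rw [run_succ, List.range_succ, List.map_append, ih1, ← ih2]; rfl
        · rw [run_succ]
          simp only [nxt, hc]
          rw [← ih2, add_sub_cancel]
    exact funext fun n => (key n).2

end GameGraph

/-!
Both equivalences rest on the determinacy of the energy game. A configuration is *losing* if
Player 2 can force a negative coordinate within some fixed number of moves, and *safe* otherwise.
Since the graph is finitely branching, Player 1 can stay inside the safe configurations and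
Player 2 can decrease a rank on the losing ones, so one of the players wins the energy game.
As no game is won by both players, it remains to prove two implications.

*Some credit is safe: Player 1 wins the bounding game* (`winsBounding_lossy_one`). Safety is upward
closed in the counters, so by Dickson's lemma the minimal safe vectors are bounded. At a vertex of
Player 1 that is not minimally safe, Player 1 takes a lossy loop to a smaller safe configuration;
otherwise Player 1 follows an edge to a safe configuration. The counters plus the credit never
become negative, and as every cycle meets Player 1, they grow only for a bounded number of moves
after each visit to a minimal configuration (`exists_rank`).

*No credit is safe: Player 2 wins the bounding game* (`winsBounding_lossy_two`). Let `U` be the set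
of the vertices at which no credit is safe. Player 1 cannot leave `U`, and Player 2 need not. If
Player 2 is confined to `U`, then still no credit is safe on `U` (`losing_confine`): with an
additional credit, Player 1 would win as soon as Player 2 leaves `U`. Lossy loops do not help
Player 1 in the energy game either (`safe_of_safe_lossy`). Hence, from any point of a play in `U`,
Player 2 can force some counter below all values that were reached before, and doing so forever
makes the play unbounded.
-/

namespace GameGraph

variable {V : Type*} {d : ℕ}

/-! ### Moves and strategies -/

/-- The configuration `c` with credit `b` added to its counters. -/
def shift (b : Fin d → ℤ) (c : Config V d) : Config V d := (c.1, b + c.2)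

theorem step_shift_iff (G : GameGraph V d) (b : Fin d → ℤ) (c c' : Config V d) :
    G.Step (shift b c) (shift b c') ↔ G.Step c c' := by
  simp [Step, shift]

theorem step_edge {G : GameGraph V d} {v w : V} {u : Fin d → ℤ} (h : (v, u, w) ∈ G.edges)
    (a : Fin d → ℤ) : G.Step (v, a) (w, a + u) := by
  simpa [Step] using h

theorem exists_step (G : GameGraph V d) (c : Config V d) : ∃ c', G.Step c c' := by
  obtain ⟨u, w, h⟩ := G.exists_edge c.1
  exact ⟨_, step_edge h c.2⟩

theorem finite_setOf_step (G : GameGraph V d) (c : Config V d) : {c' | G.Step c c'}.Finite := by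
  refine (G.finite_edges.image fun e => (e.2.2, c.2 + e.2.1)).subset fun c' h => ?_
  exact ⟨_, h, by simp⟩

theorem Step.lossy [Finite V] {G : GameGraph V d} {c c' : Config V d} (h : G.Step c c') :
    G.lossy.Step c c' :=
  Or.inl h

theorem Step.of_lossy_two [Finite V] {G : GameGraph V d} {c c' : Config V d}
    (ho : G.owner c.1 = .two) (h : G.lossy.Step c c') : G.Step c c' := by
  rcases h with h | ⟨v, i, hv, h⟩
  · exact h
  · simp only [Prod.mk.injEq] at h
    rw [h.1, hv] at ho
    cases ho

/-- A player wins if some rule `Q`, with which the player can comply after every history,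
guarantees that the play is won. -/
theorem wins_of_rule (G : GameGraph V d) {W : (ℕ → Config V d) → Prop} {p : Player} {v₀ : V}
    (Q : List (Config V d) → Config V d → Config V d → Prop)
    (hQ : ∀ π c, G.owner c.1 = p → ∃ c', G.Step c c' ∧ Q π c c')
    (hW : ∀ ρ, G.IsPlayFrom v₀ ρ →
      (∀ n, G.owner (ρ n).1 = p → Q ((List.range n).map ρ) (ρ n) (ρ (n + 1))) →
      WinsPlay W p ρ) :
    G.Wins W p v₀ := by
  have hQ' : ∀ π c, ∃ c', G.owner c.1 = p → G.Step c c' ∧ Q π c c' := by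
    intro π c
    by_cases h : G.owner c.1 = p
    · obtain ⟨c', hc'⟩ := hQ π c h
      exact ⟨c', fun _ => hc'⟩
    · exact ⟨c, fun h' => absurd h' h⟩
  choose f hf using hQ'
  refine ⟨⟨fun π c => (c.1, (f π c).2 - c.2, (f π c).1), fun π c _ h => (hf π c h).1,
    fun π c _ _ => rfl⟩, fun τ ρ hρ hσ _ => hW ρ hρ fun n hn => ?_⟩
  have h := hσ n hn
  simp only [Prod.mk.injEq, true_and, sub_left_inj] at h
  have : ρ (n + 1) = f ((List.range n).map ρ) (ρ n) := Prod.ext h.2.symm h.1.symm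
  rw [this]
  exact (hf _ _ hn).2

theorem not_wins_two_of_wins_one {G : GameGraph V d} {W : (ℕ → Config V d) → Prop} {v₀ : V}
    (h₁ : G.Wins W .one v₀) : ¬ G.Wins W .two v₀ := by
  rintro ⟨τ, hτ⟩
  obtain ⟨σ, hσ⟩ := h₁
  obtain ⟨ρ, ⟨hρ, hσρ, hτρ⟩, -⟩ := G.existsUnique_play σ τ v₀
  exact hτ σ ρ hρ hτρ hσρ (hσ τ ρ hρ hσρ hτρ)

/-! ### Determinacy of the energy game -/

/-- Player 2 can force a negative coordinate within `n` moves. -/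
def LosingWithin (G : GameGraph V d) : ℕ → Config V d → Prop
  | 0, c => ¬ 0 ≤ c.2
  | n + 1, c => ¬ 0 ≤ c.2 ∨
      (G.owner c.1 = .two ∧ ∃ c', G.Step c c' ∧ G.LosingWithin n c') ∨
      (G.owner c.1 = .one ∧ ∀ c', G.Step c c' → G.LosingWithin n c')

/-- Player 2 can force a negative coordinate within some number of moves. -/
def Losing (G : GameGraph V d) (c : Config V d) : Prop := ∃ n, G.LosingWithin n c

/-- Player 1 can keep all coordinates nonnegative, as the complement of `Losing`. -/
def Safe (G : GameGraph V d) (c : Config V d) : Prop := ¬ G.Losing c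

/-- The least number of moves within which Player 2 can force a negative coordinate. It is `0` on
safe configurations. -/
noncomputable def losingRank (G : GameGraph V d) (c : Config V d) : ℕ :=
  sInf {n | G.LosingWithin n c}

theorem LosingWithin.succ {G : GameGraph V d} {n : ℕ} {c : Config V d} (h : G.LosingWithin n c) :
    G.LosingWithin (n + 1) c := by
  induction n generalizing c with
  | zero => exact Or.inl h
  | succ n ih =>
    rcases h with h | ⟨ho, c', hs, h⟩ | ⟨ho, h⟩
    · exact Or.inl h
    · exact Or.inr (Or.inl ⟨ho, c', hs, ih h⟩)
    · exact Or.inr (Or.inr ⟨ho, fun c' hs => ih (h c' hs)⟩)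

theorem LosingWithin.mono {G : GameGraph V d} {n m : ℕ} {c : Config V d} (hnm : n ≤ m)
    (h : G.LosingWithin n c) : G.LosingWithin m c := by
  induction hnm with
  | refl => exact h
  | step _ ih => exact ih.succ

theorem Safe.nonneg {G : GameGraph V d} {c : Config V d} (h : G.Safe c) : 0 ≤ c.2 := by
  by_contra hc
  exact h ⟨0, hc⟩

theorem Safe.step_of_two {G : GameGraph V d} {c c' : Config V d} (h : G.Safe c)
    (ho : G.owner c.1 = .two) (hs : G.Step c c') : G.Safe c' :=
  fun ⟨n, hn⟩ => h ⟨n + 1, Or.inr (Or.inl ⟨ho, c', hs, hn⟩)⟩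

/-- Finite branching turns bounds on the numbers of moves after each step into a common one. -/
theorem Safe.exists_step {G : GameGraph V d} {c : Config V d} (h : G.Safe c)
    (ho : G.owner c.1 = .one) : ∃ c', G.Step c c' ∧ G.Safe c' := by
  by_contra! hc
  have hev : ∀ᶠ n in Filter.atTop, ∀ c' ∈ {c' | G.Step c c'}, G.LosingWithin n c' := by
    rw [Filter.eventually_all_finite (G.finite_setOf_step c)]
    intro c' hs
    obtain ⟨n, hn⟩ := not_not.1 (hc c' hs)
    filter_upwards [Filter.eventually_ge_atTop n] with m hm using hn.mono hm
  obtain ⟨n, hn⟩ := hev.exists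
  exact h ⟨n + 1, Or.inr (Or.inr ⟨ho, hn⟩)⟩

/-- Coinduction: a set of nonnegative configurations that Player 1 can stay in is safe. -/
theorem safe_of_invariant {G : GameGraph V d} (X : Config V d → Prop)
    (h0 : ∀ c, X c → 0 ≤ c.2)
    (h1 : ∀ c, X c → G.owner c.1 = .one → ∃ c', G.Step c c' ∧ X c')
    (h2 : ∀ c, X c → G.owner c.1 = .two → ∀ c', G.Step c c' → X c')
    {c : Config V d} (hc : X c) : G.Safe c := by
  rintro ⟨n, hn⟩
  induction n generalizing c with
  | zero => exact hn (h0 c hc)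
  | succ n ih =>
    rcases hn with hn | ⟨ho, c', hs, hn⟩ | ⟨ho, hn⟩
    · exact hn (h0 c hc)
    · exact ih (h2 c hc ho c' hs) hn
    · obtain ⟨c', hs, hX⟩ := h1 c hc ho
      exact ih hX (hn c' hs)

theorem safe_of_step {G : GameGraph V d} {c : Config V d} (h0 : 0 ≤ c.2)
    (h1 : G.owner c.1 = .one → ∃ c', G.Step c c' ∧ G.Safe c')
    (h2 : G.owner c.1 = .two → ∀ c', G.Step c c' → G.Safe c') : G.Safe c := by
  rintro ⟨n | n, hn⟩
  · exact hn h0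
  · rcases hn with hn | ⟨ho, c', hs, hn⟩ | ⟨ho, hn⟩
    · exact hn h0
    · exact h2 ho c' hs ⟨n, hn⟩
    · obtain ⟨c', hs, hc'⟩ := h1 ho
      exact hc' ⟨n, hn c' hs⟩

theorem Safe.shift {G : GameGraph V d} {c : Config V d} (h : G.Safe c) {b : Fin d → ℤ}
    (hb : 0 ≤ b) : G.Safe (shift b c) := by
  refine safe_of_invariant (fun x => ∃ c, G.Safe c ∧ x = GameGraph.shift b c) ?_ ?_ ?_ ⟨c, h, rfl⟩
  · rintro _ ⟨c, hc, rfl⟩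
    exact add_nonneg hb hc.nonneg
  · rintro _ ⟨c, hc, rfl⟩ ho
    obtain ⟨c', hs, hc'⟩ := hc.exists_step ho
    exact ⟨_, (G.step_shift_iff b c c').2 hs, c', hc', rfl⟩
  · rintro _ ⟨c, hc, rfl⟩ ho x hs
    have hx : x = GameGraph.shift b (GameGraph.shift (-b) x) := by simp [GameGraph.shift]
    rw [hx, step_shift_iff] at hs
    exact ⟨_, hc.step_of_two ho hs, hx⟩

/-- Safety is upward closed in the counters. -/
theorem Safe.mono {G : GameGraph V d} {v : V} {a a' : Fin d → ℤ} (h : G.Safe (v, a))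
    (ha : a ≤ a') : G.Safe (v, a') := by
  simpa [GameGraph.shift] using h.shift (sub_nonneg.2 ha)

theorem losingWithin_losingRank {G : GameGraph V d} {c : Config V d} (h : G.Losing c) :
    G.LosingWithin (G.losingRank c) c :=
  Nat.sInf_mem h

theorem exists_losingRank_eq_succ {G : GameGraph V d} {c : Config V d} (h : G.Losing c)
    (h0 : 0 ≤ c.2) : ∃ n, G.losingRank c = n + 1 ∧
      ((G.owner c.1 = .two ∧ ∃ c', G.Step c c' ∧ G.LosingWithin n c') ∨
      (G.owner c.1 = .one ∧ ∀ c', G.Step c c' → G.LosingWithin n c')) := by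
  have hr := losingWithin_losingRank h
  rcases hn : G.losingRank c with _ | n
  · rw [hn] at hr
    exact absurd h0 hr
  · rw [hn] at hr
    exact ⟨n, rfl, hr.resolve_left (not_not.2 h0)⟩

theorem losingRank_lt_of_losingWithin {G : GameGraph V d} {c : Config V d} {n : ℕ}
    (h : G.LosingWithin n c) : G.losingRank c < n + 1 :=
  Nat.lt_succ_of_le (Nat.sInf_le h)

theorem Losing.exists_step {G : GameGraph V d} {c : Config V d} (h : G.Losing c) (h0 : 0 ≤ c.2)
    (ho : G.owner c.1 = .two) :
    ∃ c', G.Step c c' ∧ G.Losing c' ∧ G.losingRank c' < G.losingRank c := by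
  obtain ⟨n, hn, ⟨-, c', hs, hc'⟩ | ⟨ho', -⟩⟩ := exists_losingRank_eq_succ h h0
  · exact ⟨c', hs, ⟨n, hc'⟩, hn ▸ losingRank_lt_of_losingWithin hc'⟩
  · rw [ho] at ho'
    cases ho'

theorem Losing.step_of_one {G : GameGraph V d} {c c' : Config V d} (h : G.Losing c) (h0 : 0 ≤ c.2)
    (ho : G.owner c.1 = .one) (hs : G.Step c c') :
    G.Losing c' ∧ G.losingRank c' < G.losingRank c := by
  obtain ⟨n, hn, ⟨ho', -⟩ | ⟨-, hc'⟩⟩ := exists_losingRank_eq_succ h h0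
  · rw [ho] at ho'
    cases ho'
  · exact ⟨⟨n, hc' c' hs⟩, hn ▸ losingRank_lt_of_losingWithin (hc' c' hs)⟩

theorem IsPlayFrom.prefixWeight_eq {G : GameGraph V d} {v₀ : V} {ρ : ℕ → Config V d}
    (h : G.IsPlayFrom v₀ ρ) (n : ℕ) : prefixWeight ρ n = (ρ n).2 := by
  simp [prefixWeight, h.1]

theorem winsEnergy_one_of_safe {G : GameGraph V d} {b : Fin d → ℕ} {v₀ : V}
    (h : G.Safe (v₀, fun i => (b i : ℤ))) : G.WinsEnergy b .one v₀ := by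
  set B : Fin d → ℤ := fun i => (b i : ℤ)
  refine G.wins_of_rule (fun _ c c' => G.Safe (shift B c) → G.Safe (shift B c')) ?_ ?_
  · intro _ c ho
    by_cases hc : G.Safe (shift B c)
    · obtain ⟨x, hs, hx⟩ := hc.exists_step ho
      have e : x = shift B (shift (-B) x) := by simp [shift]
      rw [e, step_shift_iff] at hs
      exact ⟨_, hs, fun _ => e ▸ hx⟩
    · obtain ⟨c', hs⟩ := G.exists_step c
      exact ⟨c', hs, fun h' => absurd h' hc⟩
  · intro ρ hρ hQ
    have key : ∀ n, G.Safe (shift B (ρ n)) := by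
      intro n
      induction n with
      | zero => simpa [hρ.1, shift] using h
      | succ n ih =>
        rcases ho : G.owner (ρ n).1 with _ | _
        · exact hQ n ho ih
        · exact ih.step_of_two ho ((G.step_shift_iff _ _ _).2 (hρ.2 n))
    intro n
    rw [hρ.prefixWeight_eq]
    exact (key n).nonneg

theorem winsEnergy_two_of_losing {G : GameGraph V d} {b : Fin d → ℕ} {v₀ : V}
    (h : G.Losing (v₀, fun i => (b i : ℤ))) : G.WinsEnergy b .two v₀ := by
  set B : Fin d → ℤ := fun i => (b i : ℤ)
  refine G.wins_of_rule (fun _ c c' => G.Losing (shift B c) → 0 ≤ (shift B c).2 →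
    G.Losing (shift B c') ∧ G.losingRank (shift B c') < G.losingRank (shift B c)) ?_ ?_
  · intro _ c ho
    by_cases hc : G.Losing (shift B c) ∧ 0 ≤ (shift B c).2
    · obtain ⟨x, hs, hx⟩ := hc.1.exists_step hc.2 ho
      have e : x = shift B (shift (-B) x) := by simp [shift]
      rw [e, step_shift_iff] at hs
      exact ⟨_, hs, fun _ _ => e ▸ hx⟩
    · obtain ⟨c', hs⟩ := G.exists_step c
      exact ⟨c', hs, fun h1 h2 => absurd ⟨h1, h2⟩ hc⟩
  · intro ρ hρ hQ hE
    have hnn : ∀ n, 0 ≤ (shift B (ρ n)).2 := fun n => by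
      have := hE n
      rwa [hρ.prefixWeight_eq] at this
    have hstep : ∀ n, G.Losing (shift B (ρ n)) → G.Losing (shift B (ρ (n + 1))) ∧
        G.losingRank (shift B (ρ (n + 1))) < G.losingRank (shift B (ρ n)) := by
      intro n hn
      rcases ho : G.owner (ρ n).1 with _ | _
      · exact hn.step_of_one (hnn n) ho ((G.step_shift_iff _ _ _).2 (hρ.2 n))
      · exact hQ n ho hn (hnn n)
    have key : ∀ n, G.Losing (shift B (ρ n)) := by
      intro n
      induction n with
      | zero => simpa [hρ.1, shift] using h
      | succ n ih => exact (hstep n ih).1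
    obtain ⟨n, hn⟩ := WellFounded.not_rel_apply_succ (r := (· < ·))
      fun n => G.losingRank (shift B (ρ n))
    exact hn (hstep n (key n)).2

/-! ### Bounding the counters when some credit is safe -/

/-- As every cycle meets Player 1, no vertex can be reached from itself by a nonempty walk along
edges out of Player 2 vertices. Hence the number of vertices reached by such walks decreases along
these edges. -/
theorem exists_rank [Finite V] {G : GameGraph V d} (hG : G.EveryCycleMeetsPlayerOne) :
    ∃ (r : V → ℕ) (N : ℕ), (∀ v, r v ≤ N) ∧
      ∀ v u w, (v, u, w) ∈ G.edges → G.owner v = .two → r w < r v := by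
  let R : V → V → Prop := fun v w => G.owner v = .two ∧ ∃ u, (v, u, w) ∈ G.edges
  have hpath : ∀ v w, Relation.TransGen R v w → ∀ a : Fin d → ℤ, ∃ π a',
      G.IsPath ((v, a) :: (π ++ [(w, a')])) ∧
        ∀ x ∈ (v, a) :: π, G.owner x.1 = .two := by
    intro v w h
    induction h using Relation.TransGen.head_induction_on with
    | @single v h =>
      obtain ⟨ho, u, hu⟩ := h
      intro a
      refine ⟨[], a + u, ?_, by simpa using ho⟩
      simpa [IsPath] using step_edge hu a
    | @head v v' h _ ih =>
      obtain ⟨ho, u, hu⟩ := h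
      intro a
      obtain ⟨π, a', hp, hπ⟩ := ih (a + u)
      refine ⟨(v', a + u) :: π, a', ?_, ?_⟩
      · exact List.isChain_cons_cons.2 ⟨step_edge hu a, hp⟩
      · intro x hx
        rcases List.mem_cons.1 hx with rfl | hx
        · exact ho
        · exact hπ x hx
  have hirr : ∀ v, ¬ Relation.TransGen R v v := by
    intro v h
    obtain ⟨π, a', hp, hπ⟩ := hpath v v h 0
    obtain ⟨x, hx, ho⟩ := hG _ _ _ hp rfl
    have hx2 : G.owner x.1 = .two := by
      rw [← List.cons_append, List.mem_append] at hx
      rcases hx with hx | hx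
      · exact hπ x hx
      · rw [List.mem_singleton.1 hx]
        exact hπ (v, 0) (by simp)
    rw [ho] at hx2
    cases hx2
  refine ⟨fun v => {w | Relation.TransGen R v w}.ncard, Nat.card V, fun v => ?_, ?_⟩
  · exact Set.ncard_le_card _
  · intro v u w hu ho
    refine Set.ncard_lt_ncard ⟨fun x hx => ?_, fun hsub => ?_⟩ (Set.toFinite _)
    · exact Relation.TransGen.head ⟨ho, u, hu⟩ hx
    · exact hirr w (hsub (Relation.TransGen.single ⟨ho, u, hu⟩))

/-- Dickson's lemma, for the safe configurations from which no coordinate can be decreased. -/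
theorem exists_bound_minimal_safe [Finite V] (G : GameGraph V d) :
    ∃ M : ℕ, ∀ (v : V) (a : Fin d → ℤ), G.Safe (v, a) →
      (∀ i, ¬ G.Safe (v, a - Pi.single i 1)) → ∀ i, a i ≤ M := by
  have hev : ∀ᶠ M : ℕ in Filter.atTop, ∀ v : V, ∀ a : Fin d → ℤ, G.Safe (v, a) →
      (∀ i, ¬ G.Safe (v, a - Pi.single i 1)) → ∀ i, a i ≤ M := by
    rw [Filter.eventually_all]
    intro v
    let S : Set (Fin d → ℕ) := {a | G.Safe (v, fun i => (a i : ℤ)) ∧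
      ∀ i, ¬ G.Safe (v, (fun i => (a i : ℤ)) - Pi.single i 1)}
    have hanti : IsAntichain (· ≤ ·) S := by
      intro a ha a' ha' hne hle
      obtain ⟨i, hi⟩ : ∃ i, a i < a' i := by
        by_contra! hc
        exact hne (le_antisymm hle hc)
      refine ha'.2 i (ha.1.mono fun j => ?_)
      have := hle j
      rcases eq_or_ne j i with rfl | hj
      · simp only [Pi.sub_apply, Pi.single_eq_same]
        omega
      · simpa [Pi.single_eq_of_ne hj] using this
    have hfin : S.Finite := WellQuasiOrderedLE.finite_of_isAntichain hanti
    obtain ⟨m, hm⟩ := hfin.bddAbove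
    filter_upwards [Filter.eventually_ge_atTop (Finset.univ.sup m)] with M hM a ha hmin i
    have hcast : (fun j => ((a j).toNat : ℤ)) = a :=
      funext fun j => Int.toNat_of_nonneg (ha.nonneg j)
    have h1 : (a i).toNat ≤ m i :=
      hm (show (fun j => (a j).toNat) ∈ S from ⟨by rwa [hcast], by rwa [hcast]⟩) i
    have h2 : m i ≤ Finset.univ.sup m := Finset.le_sup (f := m) (Finset.mem_univ i)
    omega
  exact hev.exists

theorem exists_bound_weight (G : GameGraph V d) :
    ∃ W : ℕ, ∀ v u w, (v, u, w) ∈ G.edges → ∀ i, u i ≤ W := by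
  have hev : ∀ᶠ W : ℕ in Filter.atTop, ∀ e ∈ G.edges, ∀ i, e.2.1 i ≤ W := by
    rw [Filter.eventually_all_finite G.finite_edges]
    intro e _
    rw [Filter.eventually_all]
    intro i
    filter_upwards [Filter.eventually_ge_atTop (e.2.1 i).toNat] with W hW
    omega
  obtain ⟨W, hW⟩ := hev.exists
  exact ⟨W, fun v u w h => hW _ h⟩

theorem winsBounding_lossy_one [Finite V] {G : GameGraph V d} (hG : G.EveryCycleMeetsPlayerOne)
    {v₀ : V} {b : Fin d → ℕ} (h : G.Safe (v₀, fun i => (b i : ℤ))) :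
    G.lossy.WinsBounding .one v₀ := by
  obtain ⟨r, N, hrN, hr⟩ := exists_rank hG
  obtain ⟨M, hM⟩ := G.exists_bound_minimal_safe
  obtain ⟨W, hW⟩ := G.exists_bound_weight
  set B : Fin d → ℤ := fun i => (b i : ℤ) with hB
  refine G.lossy.wins_of_rule (fun _ c c' => G.Safe (shift B c) → G.Safe (shift B c') ∧
    ((c'.1 = c.1 ∧ c'.2 ≤ c.2) ∨ (G.Step c c' ∧ ∀ i, B i + c.2 i ≤ M))) ?_ ?_
  · intro _ c ho
    by_cases hc : G.Safe (shift B c)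
    · by_cases hmin : ∀ i, ¬ G.Safe (c.1, (B + c.2) - Pi.single i 1)
      · obtain ⟨x, hs, hx⟩ := hc.exists_step ho
        have e : x = shift B (shift (-B) x) := by simp [shift]
        rw [e, step_shift_iff] at hs
        exact ⟨_, hs.lossy, fun _ => ⟨e ▸ hx, Or.inr ⟨hs, hM c.1 _ hc hmin⟩⟩⟩
      · push Not at hmin
        obtain ⟨i, hi⟩ := hmin
        refine ⟨(c.1, c.2 - Pi.single i 1), Or.inr ⟨c.1, i, ho, by simp⟩,
          fun _ => ⟨?_, Or.inl ⟨rfl, ?_⟩⟩⟩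
        · simpa [shift, add_sub_assoc] using hi
        · exact sub_le_self _ (Pi.single_nonneg.2 zero_le_one)
    · obtain ⟨c', hs⟩ := G.lossy.exists_step c
      exact ⟨c', hs, fun h' => absurd h' hc⟩
  · intro ρ hρ hQ
    -- A minimal configuration is bounded by `M`. Until the next one, the counters grow only with
    -- the move out of it and along edges that decrease the rank, so at most `N + 1` times.
    set K : ℕ := M + Finset.univ.sup b with hK
    have hbK : ∀ i, B i ≤ K := fun i => by
      have : b i ≤ Finset.univ.sup b := Finset.le_sup (Finset.mem_univ i)
      simp only [hB]
      omega
    have key : ∀ n, G.Safe (shift B (ρ n)) ∧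
        ∀ i, B i + (ρ n).2 i ≤ K + W * ((N : ℤ) + 1 - r (ρ n).1) := by
      intro n
      induction n with
      | zero =>
        refine ⟨by simpa [hρ.1, shift] using h, fun i => ?_⟩
        have h1 : (0 : ℤ) ≤ W * ((N : ℤ) + 1 - r (ρ 0).1) :=
          mul_nonneg (by positivity) (by have := hrN (ρ 0).1; omega)
        have h2 : (ρ 0).2 i = 0 := by simp [hρ.1]
        linarith [hbK i]
      | succ n ih =>
        obtain ⟨hsafe, hbd⟩ := ih
        have hweight : G.Step (ρ n) (ρ (n + 1)) → ∀ i, (ρ (n + 1)).2 i ≤ (ρ n).2 i + W := by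
          intro hs i
          have := hW _ _ _ hs i
          simp only [Pi.sub_apply] at this
          linarith
        rcases ho : G.owner (ρ n).1 with _ | _
        · obtain ⟨hsafe', ⟨hv, hle⟩ | ⟨hs, hmin⟩⟩ := hQ n ho hsafe
          · refine ⟨hsafe', fun i => ?_⟩
            rw [hv]
            linarith [hbd i, hle i]
          · refine ⟨hsafe', fun i => ?_⟩
            have h1 : (W : ℤ) * 1 ≤ W * ((N : ℤ) + 1 - r (ρ (n + 1)).1) :=
              mul_le_mul_of_nonneg_left (by have := hrN (ρ (n + 1)).1; omega) (by positivity)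
            have h2 : (M : ℤ) ≤ K := by omega
            linarith [hweight hs i, hmin i]
        · have hs := (hρ.2 n).of_lossy_two ho
          refine ⟨hsafe.step_of_two ho ((G.step_shift_iff _ _ _).2 hs), fun i => ?_⟩
          have h1 : (W : ℤ) * ((N : ℤ) + 1 - r (ρ n).1 + 1) ≤
              W * ((N : ℤ) + 1 - r (ρ (n + 1)).1) :=
            mul_le_mul_of_nonneg_left (by have := hr _ _ _ hs ho; omega) (by positivity)
          linarith [hweight hs i, hbd i]
    refine ⟨((K + W * (N + 1) : ℕ) : ℝ), ?_⟩
    rintro _ ⟨n, rfl⟩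
    simp only [hρ.prefixWeight_eq]
    refine (pi_norm_le_iff_of_nonneg (Nat.cast_nonneg _)).2 fun i => ?_
    obtain ⟨hsafe, hbd⟩ := key n
    have h1 : 0 ≤ B i + (ρ n).2 i := hsafe.nonneg i
    have h2 : (W : ℤ) * ((N : ℤ) + 1 - r (ρ n).1) ≤ W * ((N : ℤ) + 1) :=
      mul_le_mul_of_nonneg_left (by omega) (by positivity)
    have h3 : (0 : ℤ) ≤ W * ((N : ℤ) + 1) := by positivity
    have h4 : (0 : ℤ) ≤ B i := by positivity
    have h5 : |(ρ n).2 i| ≤ ((K + W * (N + 1) : ℕ) : ℤ) := by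
      push_cast
      exact abs_le.2 ⟨by linarith [hbK i], by linarith [hbd i]⟩
    rw [Int.norm_eq_abs]
    exact_mod_cast h5

/-! ### Unbounded plays when no credit is safe -/

/-- Lossy loops are useless in the energy game: they only decrease the counters, so after finitely
many of them Player 1 has to take an edge that was already available before. -/
theorem safe_of_safe_lossy [Finite V] {G : GameGraph V d} {c : Config V d}
    (h : G.lossy.Safe c) : G.Safe c := by
  refine safe_of_invariant (G := G) G.lossy.Safe (fun c hc => hc.nonneg) ?_
    (fun c hc ho c' hs => hc.step_of_two ho (Step.lossy (G := G) hs)) h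
  suffices H : ∀ (n : ℕ) (c : Config V d), ∑ i, (c.2 i).toNat = n → G.lossy.Safe c →
      G.owner c.1 = .one → ∃ c', G.Step c c' ∧ G.lossy.Safe c' from
    fun c hc ho => H _ c rfl hc ho
  intro n
  induction n using Nat.strong_induction_on with
  | _ n ih =>
    intro c hn hc ho
    obtain ⟨c', hs, hc'⟩ := hc.exists_step ho
    rcases hs with hs | ⟨v, i, -, he⟩
    · exact ⟨c', hs, hc'⟩
    · simp only [Prod.mk.injEq] at he
      obtain ⟨rfl, hsub, hv⟩ := he
      have he' : c'.2 = c.2 - Pi.single i 1 := by rw [sub_eq_iff_eq_add.1 hsub]; abel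
      have hle : ∀ j, c'.2 j ≤ c.2 j := fun j => by
        rw [he']
        exact sub_le_self (c.2) (Pi.single_nonneg.2 zero_le_one) j
      have hlt : ∑ j, (c'.2 j).toNat < n := by
        rw [← hn]
        refine Finset.sum_lt_sum (fun j _ => Int.toNat_le_toNat (hle j)) ⟨i, Finset.mem_univ i, ?_⟩
        have h1 : c'.2 i = c.2 i - 1 := by rw [he']; simp
        have h2 : 0 ≤ c'.2 i := hc'.nonneg i
        omega
      obtain ⟨x, hsx, hx⟩ := ih _ hlt c' rfl hc' (hv ▸ ho)
      refine ⟨(x.1, Pi.single i 1 + x.2), ?_, hx.shift (Pi.single_nonneg.2 zero_le_one)⟩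
      have hc : c = shift (Pi.single i 1) c' := Prod.ext hv.symm (by simp [shift, he'])
      rw [hc]
      exact (G.step_shift_iff _ c' x).2 hsx

/-- The vertices at which Player 1 loses the energy game with every credit. -/
def hopeless (G : GameGraph V d) : Set V := {v | ∀ a, G.Losing (v, a)}

/-- A credit that suffices after every move out of the hopeless vertices. -/
theorem exists_credit (G : GameGraph V d) : ∃ K : ℕ, ∀ v u w, (v, u, w) ∈ G.edges →
    w ∉ G.hopeless → ∀ a : Fin d → ℤ, (∀ i, (K : ℤ) ≤ a i) → G.Safe (w, a + u) := by
  have hev : ∀ᶠ K : ℕ in Filter.atTop, ∀ e ∈ G.edges, e.2.2 ∉ G.hopeless →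
      ∀ a : Fin d → ℤ, (∀ i, (K : ℤ) ≤ a i) → G.Safe (e.2.2, a + e.2.1) := by
    rw [Filter.eventually_all_finite G.finite_edges]
    intro e _
    by_cases he : e.2.2 ∈ G.hopeless
    · exact Filter.Eventually.of_forall fun _ h => absurd he h
    · obtain ⟨x, hx⟩ : ∃ x, G.Safe (e.2.2, x) := not_forall.1 he
      filter_upwards [Filter.eventually_ge_atTop
        (Finset.univ.sup fun i => (x i - e.2.1 i).toNat)] with K hK _ a ha
      refine hx.mono fun i => ?_
      have h1 : (x i - e.2.1 i).toNat ≤ Finset.univ.sup fun i => (x i - e.2.1 i).toNat :=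
        Finset.le_sup (f := fun i => (x i - e.2.1 i).toNat) (Finset.mem_univ i)
      have h2 := ha i
      simp only [Pi.add_apply]
      omega
  obtain ⟨K, hK⟩ := hev.exists
  exact ⟨K, fun v u w h => hK _ h⟩

theorem mem_hopeless_of_edge_one {G : GameGraph V d} {v w : V} {u : Fin d → ℤ}
    (hv : v ∈ G.hopeless) (ho : G.owner v = .one) (h : (v, u, w) ∈ G.edges) :
    w ∈ G.hopeless := by
  by_contra hw
  obtain ⟨K, hK⟩ := G.exists_credit
  have := hK v u w h hw (fun _ => K) fun _ => le_rfl
  refine safe_of_step (G := G) (c := (v, fun _ => (K : ℤ))) (fun _ => by simp)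
    (fun _ => ⟨_, step_edge h _, this⟩) (fun ho' => ?_) (hv _)
  rw [ho] at ho'
  cases ho'

theorem exists_edge_hopeless {G : GameGraph V d} {v : V} (hv : v ∈ G.hopeless) :
    ∃ u w, (v, u, w) ∈ G.edges ∧ w ∈ G.hopeless := by
  rcases ho : G.owner v with _ | _
  · obtain ⟨u, w, h⟩ := G.exists_edge v
    exact ⟨u, w, h, mem_hopeless_of_edge_one hv ho h⟩
  · by_contra! hc
    obtain ⟨K, hK⟩ := G.exists_credit
    refine safe_of_step (G := G) (c := (v, fun _ => (K : ℤ))) (fun _ => by simp)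
      (fun ho' => ?_) (fun _ c' hs => ?_) (hv _)
    · rw [ho] at ho'
      cases ho'
    · have := hK _ _ _ hs (hc _ _ hs) (fun _ => K) fun _ => le_rfl
      simpa using this

/-- The game graph without the edges that leave the set of hopeless vertices. -/
def confine (G : GameGraph V d) : GameGraph V d where
  owner := G.owner
  edges := {e ∈ G.edges | e.1 ∈ G.hopeless → e.2.2 ∈ G.hopeless}
  finite_edges := G.finite_edges.subset fun _ h => h.1
  exists_edge v := by
    by_cases hv : v ∈ G.hopeless
    · obtain ⟨u, w, h, hw⟩ := exists_edge_hopeless hv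
      exact ⟨u, w, h, fun _ => hw⟩
    · obtain ⟨u, w, h⟩ := G.exists_edge v
      exact ⟨u, w, h, fun h' => absurd h' hv⟩

/-- Confining Player 2 to the hopeless vertices does not help Player 1: otherwise, in the original
game, Player 1 could put aside a credit that suffices once Player 2 leaves these vertices. -/
theorem losing_confine {G : GameGraph V d} {v : V} (hv : v ∈ G.hopeless) (a : Fin d → ℤ) :
    G.confine.Losing (v, a) := by
  by_contra hsafe
  obtain ⟨K, hK⟩ := G.exists_credit
  set k : Fin d → ℤ := fun _ => (K : ℤ) with hk
  refine safe_of_invariant (G := G) (fun x => G.Safe x ∨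
    (x.1 ∈ G.hopeless ∧ ∃ c, G.confine.Safe c ∧ x = shift k c)) ?_ ?_ ?_
    (Or.inr ⟨hv, (v, a), hsafe, rfl⟩) (hv _)
  · rintro x (hx | ⟨-, c, hc, rfl⟩)
    · exact hx.nonneg
    · exact add_nonneg (fun _ => by simp [hk]) hc.nonneg
  · rintro x (hx | ⟨hU, c, hc, rfl⟩) ho
    · obtain ⟨c', hs, hc'⟩ := hx.exists_step ho
      exact ⟨c', hs, Or.inl hc'⟩
    · obtain ⟨c', hs, hc'⟩ := hc.exists_step ho
      exact ⟨_, (G.step_shift_iff k c c').2 hs.1, Or.inr ⟨hs.2 hU, c', hc', rfl⟩⟩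
  · rintro x (hx | ⟨hU, c, hc, rfl⟩) ho x' hs
    · exact Or.inl (hx.step_of_two ho hs)
    · by_cases hU' : x'.1 ∈ G.hopeless
      · have e : x' = shift k (shift (-k) x') := by simp [shift]
        refine Or.inr ⟨hU', shift (-k) x', hc.step_of_two ho ⟨?_, fun _ => hU'⟩, e⟩
        rw [e, step_shift_iff] at hs
        exact hs
      · have h := hK _ _ _ hs hU' (shift k c).2 fun i => by
          have := hc.nonneg i
          simpa [shift, hk] using this
        rw [add_sub_cancel] at h
        exact Or.inl h

theorem losing_lossy_confine [Finite V] {G : GameGraph V d} {v : V} (hv : v ∈ G.hopeless)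
    (a : Fin d → ℤ) : G.confine.lossy.Losing (v, a) := by
  by_contra h
  exact safe_of_safe_lossy h (losing_confine hv a)

/-- The largest amount by which a coordinate of `c` is below zero. -/
def deficit (c : Config V d) : ℕ := Finset.univ.sup fun i => (-c.2 i).toNat

theorem le_deficit (c : Config V d) (i : Fin d) : -c.2 i ≤ deficit c := by
  have : (-c.2 i).toNat ≤ deficit c :=
    Finset.le_sup (f := fun i => (-c.2 i).toNat) (Finset.mem_univ i)
  omega

/-- The largest deficit along a list of configurations. -/
def maxDeficit (π : List (Config V d)) : ℕ := π.foldl (fun m c => max m (deficit c)) 0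

theorem maxDeficit_concat (π : List (Config V d)) (c : Config V d) :
    maxDeficit (π ++ [c]) = max (maxDeficit π) (deficit c) := by
  simp [maxDeficit]

theorem winsBounding_lossy_two [Finite V] {G : GameGraph V d} {v₀ : V} (h : v₀ ∈ G.hopeless) :
    G.lossy.WinsBounding .two v₀ := by
  -- Player 2 plays as in the energy game whose credit is the largest deficit reached so far:
  -- that credit is exhausted exactly if the deficit exceeds all earlier ones.
  let k : ℕ → Fin d → ℤ := fun m _ => m
  let H := G.confine.lossy
  refine G.lossy.wins_of_rule (fun π c c' => c.1 ∈ G.hopeless →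
    c'.1 ∈ G.hopeless ∧ H.losingRank (shift (k (maxDeficit (π ++ [c]))) c') <
      H.losingRank (shift (k (maxDeficit (π ++ [c]))) c)) ?_ ?_
  · intro π c ho
    by_cases hc : c.1 ∈ G.hopeless
    · set K := k (maxDeficit (π ++ [c])) with hK
      have hnn : 0 ≤ (shift K c).2 := by
        intro i
        have h1 := le_deficit c i
        have h2 : deficit c ≤ maxDeficit (π ++ [c]) := by simp [maxDeficit_concat]
        simp only [shift, hK, k, Pi.zero_apply, Pi.add_apply]
        omega
      obtain ⟨x, hs, -, hx⟩ := (losing_lossy_confine hc (K + c.2)).exists_step hnn ho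
      have e : x = shift K (shift (-K) x) := by simp [shift]
      have hs' : G.confine.Step (shift K c) x := Step.of_lossy_two (G := G.confine) ho hs
      refine ⟨shift (-K) x, ?_, fun _ => ⟨hs'.2 hc, e ▸ hx⟩⟩
      rw [← G.lossy.step_shift_iff K, ← e]
      exact Or.inl hs'.1
    · obtain ⟨c', hs⟩ := G.lossy.exists_step c
      exact ⟨c', hs, fun h' => absurd h' hc⟩
  · rintro ρ hρ hQ ⟨b, hb⟩
    let m : ℕ → ℕ := fun n => maxDeficit ((List.range (n + 1)).map ρ)
    have m_eq : ∀ n, maxDeficit ((List.range n).map ρ ++ [ρ n]) = m n := fun n => by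
      simp [m, List.range_succ]
    have m_succ : ∀ n, m (n + 1) = max (m n) (deficit (ρ (n + 1))) := fun n => by
      rw [← m_eq (n + 1), maxDeficit_concat]
    have def_le : ∀ n, deficit (ρ n) ≤ m n := fun n => by
      rw [← m_eq, maxDeficit_concat]
      exact le_max_right _ _
    have step : ∀ n, (ρ n).1 ∈ G.hopeless → (ρ (n + 1)).1 ∈ G.hopeless ∧
        H.losingRank (shift (k (m n)) (ρ (n + 1))) < H.losingRank (shift (k (m n)) (ρ n)) := by
      intro n hn
      rcases ho : G.owner (ρ n).1 with _ | _
      · have hs : H.Step (ρ n) (ρ (n + 1)) := (hρ.2 n).imp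
          (fun hs => ⟨hs, fun _ => mem_hopeless_of_edge_one hn ho hs⟩) id
        have hU : (ρ (n + 1)).1 ∈ G.hopeless := by
          rcases hs with hs | ⟨v, i, -, he⟩
          · exact hs.2 hn
          · simp only [Prod.mk.injEq] at he
            rwa [he.2.2, ← he.1]
        refine ⟨hU, ((losing_lossy_confine hn _).step_of_one (c := shift (k (m n)) (ρ n)) ?_ ho
          ((H.step_shift_iff _ _ _).2 hs)).2⟩
        intro i
        have h1 := le_deficit (ρ n) i
        have h2 := def_le n
        simp only [shift, k, Pi.zero_apply, Pi.add_apply]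
        omega
      · simpa only [m_eq] using hQ n ho hn
    have hU : ∀ n, (ρ n).1 ∈ G.hopeless := by
      intro n
      induction n with
      | zero => simpa [hρ.1] using h
      | succ n ih => exact (step n ih).1
    have def_bdd : ∀ n, deficit (ρ n) ≤ ⌈b⌉₊ := by
      intro n
      refine Finset.sup_le fun i _ => ?_
      have h1 : ‖(ρ n).2‖ ≤ b := by
        have := hb ⟨n, rfl⟩
        simpa only [hρ.prefixWeight_eq] using this
      have h2 : ‖(ρ n).2 i‖ ≤ ⌈b⌉₊ := ((norm_le_pi_norm _ i).trans h1).trans (Nat.le_ceil b)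
      rw [Int.norm_eq_abs] at h2
      have h3 : |(ρ n).2 i| ≤ (⌈b⌉₊ : ℤ) := by exact_mod_cast h2
      have := abs_le.1 h3
      omega
    have m_bdd : ∀ n, m n ≤ ⌈b⌉₊ := by
      intro n
      induction n with
      | zero =>
        rw [← m_eq, maxDeficit_concat]
        simpa [maxDeficit] using def_bdd 0
      | succ n ih => exact m_succ n ▸ max_le ih (def_bdd _)
    have m_mono : Monotone m := monotone_nat_of_le_succ fun n => m_succ n ▸ le_max_left _ _
    -- The bounded deficit is eventually constant, and from then on the rank decreases forever.
    obtain ⟨n₀, hn₀⟩ : ∃ n₀, ∀ n, m n ≤ m n₀ := by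
      obtain ⟨x, ⟨n₀, rfl⟩, hx⟩ :=
        (Set.finite_Iic ⌈b⌉₊ |>.subset (Set.range_subset_iff.2 m_bdd)).exists_maximal
          (Set.range_nonempty m)
      exact ⟨n₀, fun n => (le_total (m n) (m n₀)).elim id fun h => hx ⟨n, rfl⟩ h⟩
    obtain ⟨n, hn⟩ := WellFounded.not_rel_apply_succ (r := (· < ·))
      fun n => H.losingRank (shift (k (m n₀)) (ρ (n₀ + n)))
    have hc : m (n₀ + n) = m n₀ := le_antisymm (hn₀ _) (m_mono (Nat.le_add_right _ _))
    have := (step _ (hU (n₀ + n))).2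
    rw [hc] at this
    exact hn this

end GameGraph

theorem mainTheorem4 {V : Type*} [Finite V] {d : ℕ} (G : GameGraph V d)
    (hG : G.EveryCycleMeetsPlayerOne) (v₀ : V) :
    ((∃ b : Fin d → ℕ, G.WinsEnergy b Player.one v₀) ↔ G.lossy.WinsBounding Player.one v₀) ∧
    ((∀ b : Fin d → ℕ, G.WinsEnergy b Player.two v₀) ↔ G.lossy.WinsBounding Player.two v₀) := by
  by_cases h : ∃ b : Fin d → ℕ, G.Safe (v₀, fun i => (b i : ℤ))
  · obtain ⟨b, hb⟩ := h
    have hE := GameGraph.winsEnergy_one_of_safe hb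
    have hB := GameGraph.winsBounding_lossy_one hG hb
    exact ⟨iff_of_true ⟨b, hE⟩ hB, iff_of_false
      (fun h => GameGraph.not_wins_two_of_wins_one hE (h b))
      (GameGraph.not_wins_two_of_wins_one hB)⟩
  · have hL : ∀ b : Fin d → ℕ, G.Losing (v₀, fun i => (b i : ℤ)) := fun b =>
      not_not.1 fun hb => h ⟨b, hb⟩
    have hE : ∀ b : Fin d → ℕ, G.WinsEnergy b Player.two v₀ := fun b =>
      GameGraph.winsEnergy_two_of_losing (hL b)
    have hU : v₀ ∈ G.hopeless := by
      intro a
      by_contra ha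
      refine GameGraph.Safe.mono ha (a' := fun i => ((a i).toNat : ℤ)) (fun i => ?_) (hL _)
      exact Int.self_le_toNat _
    have hB := GameGraph.winsBounding_lossy_two hU
    exact ⟨iff_of_false (fun ⟨b, hb⟩ => GameGraph.not_wins_two_of_wins_one hb (hE b))
      (fun h => GameGraph.not_wins_two_of_wins_one h hB), iff_of_true hE hB⟩
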